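/- Let $\mathbb{F}_q$ be a finite field with $q$ elements, $\mathbf{A}=\mathbb{F}_q[T]$, $\mathbf{k}=\mathbb{F}_q(T)$, and let $\mathbf{k}^{\mathrm{alg}}$ be an algebraic closure of $\mathbf{k}$. Let $a\mapsto C_a$ be the Carlitz module, i.e. the $\mathbb{F}_q$-algebra homomorphism from $\mathbf{A}$ to the ring of twisted polynomials in $\tau\colon x\mapsto x^q$ with $C_T=T+\tau$. Let $\wp\in\mathbf{A}$ be a monic prime, put $\Lambda_\wp=\{\lambda\in\mathbf{k}^{\mathrm{alg}} : C_\wp(\lambda)=0\}$, and let $\lambda_\wp$ be a generator of $\Lambda_\wp$ as an $\mathbf{A}$-module, where $a\in\mathbf{A}$ acts as $C_a$. Let $\mathbb{K}_\wp=\mathbf{k}(\Lambda_\wp)$, and let $\mathcal{O}_\wp$ be the integral closure of $\mathbf{A}$ in $\mathbb{K}_\wp$. Let $\mathfrak{g}\in\mathbf{A}$ be a primitive root modulo $\wp$, i.e. its class generates $(\mathbf{A}/\wp\mathbf{A})^\times$. Then there is a unique $\sigma_{\mathfrak{g}}\in\mathrm{Gal}(\mathbb{K}_\wp/\mathbf{k})$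 with $\sigma_{\mathfrak{g}}(\lambda_\wp)=C_{\mathfrak{g}}(\lambda_\wp)$. Let $\mathcal{G}_\wp$ be the group of all $\delta/\sigma_{\mathfrak{g}}(\delta)$ with $\delta$ a unit of $\mathcal{O}_\wp$. For every unit $\epsilon$ of $\mathcal{O}_\wp$ with $\mathrm{Norm}_{\mathbb{K}_\wp/\mathbf{k}}(\epsilon)=1$ there exist an integer $\ell$ with $0\le\ell\le q^{\deg\wp}-2$ and an element $\kappa\in\mathcal{G}_\wp$ such that $$\epsilon=\left(\frac{\lambda_\wp}{C_{\mathfrak{g}}(\lambda_\wp)}\right)^{\ell}\kappa .$$ This representation is unique: if also $\epsilon=\left(\lambda_\wp/C_{\mathfrak{g}}(\lambda_\wp)\right)^{\ell_\star}\kappa_\star$ with $0\le\ell_\star\le q^{\deg\wp}-2$ and $\kappa_\star\in\mathcal{G}_\wp$, then $\ell_\star=\ell$ and $\kappa_\star=\kappa$. -/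

import Mathlib

open Polynomial

noncomputable section

namespace Carlitz

/-- The `F`-linear map `τ : x ↦ x ^ q`, where `q` is the number of elements of the finite
field `F`. -/
def tau (F : Type*) [Field F] [Finite F] (R : Type*) [CommRing R] [Algebra F R] :
    Module.End F R :=
  letI := Fintype.ofFinite F
  (FiniteField.frobeniusAlgHom F R).toLinearMap

theorem tau_apply (F : Type*) [Field F] [Finite F] (R : Type*) [CommRing R] [Algebra F R]
    (x : R) : tau F R x = x ^ Nat.card F := by
  let := Fintype.ofFinite F
  rw [Nat.card_eq_fintype_card]
  rfl

/-- The Carlitz module: the `F`-algebra homomorphism `a ↦ C_a` on `A = F[T]` with `C_T = T + τ`.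
The twisted polynomial `C_a` is regarded as the additive operator `x ↦ C_a(x)` on an
`A`-algebra `R`, so that multiplication of twisted polynomials is composition. -/
def carlitz (F : Type*) [Field F] [Finite F] (R : Type*) [CommRing R] [Algebra F R]
    [Algebra F[X] R] [IsScalarTower F F[X] R] : F[X] →ₐ[F] Module.End F R :=
  aeval (LinearMap.mulLeft F (algebraMap F[X] R X) + tau F R)

theorem carlitz_X (F : Type*) [Field F] [Finite F] (R : Type*) [CommRing R] [Algebra F R]
    [Algebra F[X] R] [IsScalarTower F F[X] R] (x : R) :
    carlitz F R X x = algebraMap F[X] R X * x + x ^ Nat.card F := by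
  simp [carlitz, tau_apply]

/-- The algebraic closure of the rational function field `k = F(T)`. -/
abbrev KAlg (F : Type*) [Field F] : Type _ := AlgebraicClosure (RatFunc F)

/-- The set `Λ_m` of roots of `C_m` in the algebraic closure of `k`. -/
def torsion (F : Type*) [Field F] [Finite F] (m : F[X]) : Set (KAlg F) :=
  {x | carlitz F (KAlg F) m x = 0}

/-- `lam` is a primitive `m`-th root of the Carlitz module: it is a root of `C_m`, and it
generates `Λ_m` as an `A`-module, where `a` acts as `C_a`. -/
def IsPrimitiveTorsion (F : Type*) [Field F] [Finite F] (m : F[X]) (lam : KAlg F) : Prop :=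
  lam ∈ torsion F m ∧ ∀ x ∈ torsion F m, ∃ a : F[X], carlitz F (KAlg F) a lam = x

/-- The `m`-th cyclotomic function field `K_m = k(Λ_m)`. -/
abbrev cyclotomicField (F : Type*) [Field F] [Finite F] (m : F[X]) :
    IntermediateField (RatFunc F) (KAlg F) :=
  IntermediateField.adjoin (RatFunc F) (torsion F m)

instance cyclotomicField.isScalarTower (F : Type*) [Field F] [Finite F] (m : F[X]) :
    IsScalarTower F F[X] (cyclotomicField F m) :=
  IsScalarTower.of_algebraMap_eq fun c =>
    Subtype.ext (IsScalarTower.algebraMap_apply F F[X] (KAlg F) c)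

/-- The ring of integers `O_m` of `K_m`: the integral closure of `A = F[T]` in `K_m`. -/
abbrev integers (F : Type*) [Field F] [Finite F] (m : F[X]) :
    Subalgebra F[X] (cyclotomicField F m) :=
  integralClosure F[X] (cyclotomicField F m)

/-- The automorphism of the group of units of `O_m` that `σ ∈ Gal(K_m / k)` induces. -/
def unitsAut (F : Type*) [Field F] [Finite F] (m : F[X])
    (σ : Gal(cyclotomicField F m / RatFunc F)) : (integers F m)ˣ →* (integers F m)ˣ :=
  Units.map (AlgEquiv.mapIntegralClosure (σ.restrictScalars F[X])).toAlgHom.toMonoidHom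

theorem coe_unitsAut (F : Type*) [Field F] [Finite F] (m : F[X])
    (σ : Gal(cyclotomicField F m / RatFunc F)) (δ : (integers F m)ˣ) :
    ((unitsAut F m σ δ : integers F m) : cyclotomicField F m) =
      σ ((δ : integers F m) : cyclotomicField F m) := rfl

/-- The group of all `δ / σ(δ)`, where `δ` is a unit of `O_m`. -/
def quotientUnits (F : Type*) [Field F] [Finite F] (m : F[X])
    (σ : Gal(cyclotomicField F m / RatFunc F)) : Subgroup (integers F m)ˣ :=
  (MonoidHom.id _ / unitsAut F m σ).range

theorem mem_quotientUnits (F : Type*) [Field F] [Finite F] (m : F[X])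
    (σ : Gal(cyclotomicField F m / RatFunc F)) (κ : (integers F m)ˣ) :
    κ ∈ quotientUnits F m σ ↔ ∃ δ : (integers F m)ˣ, δ / unitsAut F m σ δ = κ := Iff.rfl

/-- `g` is a primitive root modulo `P`: its residue class generates `(A / PA)ˣ`. -/
def IsPrimitiveRootMod {F : Type*} [Field F] (P g : F[X]) : Prop :=
  ∃ u : (F[X] ⧸ Ideal.span {P})ˣ,
    (u : F[X] ⧸ Ideal.span {P}) = Ideal.Quotient.mk (Ideal.span {P}) g ∧
      Subgroup.zpowers u = ⊤

end Carlitz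

end

/-!
Write `B = O_P`, `x = λ_P`, `G = Gal(K_P / k)` and `N = |G|`. By Hilbert's Theorem 90
(`exists_mul_smul_eq`), a unit `ε` of norm `1` is `y / σ(y)` for some nonzero `y ∈ B`, and then the
ideal `(y)` is invariant under `G`. The extension is totally ramified at `P`, with `(x)` the prime
above `P`, and unramified at all other primes of the principal ideal domain `A`. So `(y)` is, up to a
power of `(x)`, generated by an element of `A`, and `ε` is `(x / σ(x)) ^ i` times some `δ / σ(δ)` with
`δ` a unit. As `P` is associated to `x ^ N`, the `N`-th power of `x / σ(x)` is itself of the form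
`δ / σ(δ)`, and `i` can be reduced modulo `N`. No further coincidence occurs, because `x ^ m` is not
associated to an element of `A` for `0 < m < N`.

The arithmetic of `B` enters only through `IsTotallyRamified`: `x` is associated to its conjugates
and to its differences with them, and `x ^ N` is associated to the prime `P`. From this,
`prime_uniformizer` shows that `x` is prime, and `exists_associated_pow_mul` describes the invariant
principal ideals. Both rest on Lagrange interpolation at the conjugates of `x`
(`eval_cofactor_mul`), whose denominator, a product of differences of conjugates, is associated to
`x ^ (N - 1)`; this replaces the theory of discriminants and of the factorization of ideals.

For the Carlitz module these hypotheses are elementary. Any two nonzero `P`-torsion points divide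
each other, and conjugates of `x` and their differences are such points. The polynomial `C_P(X)` is
monic of degree `q ^ deg P` with linear coefficient `P`, so `P` is the product of the negatives of
its nonzero roots and is associated to `x ^ (q ^ deg P - 1)`. Finally `N = q ^ deg P - 1`: the action
of `G` on `x` gives at most that many automorphisms, and if there were fewer, the norm of `x` would be
a proper nonunit divisor of the prime `P` (`card_eq_of_associated_pow`). Hence `G` permutes the
nonzero torsion points simply transitively, so that `σ_g` exists, is unique, and generates `G`.
-/

noncomputable section

namespace InvariantIdeal

variable {A B G : Type*} [CommRing A] [CommRing B] [Algebra A B]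
  [Group G] [MulSemiringAction G B]

/-! ### Totally ramified uniformizers -/

/-- Divisibility in `B` between elements of `A` descends to `A`. -/
theorem dvd_of_algebraMap_dvd {A B : Type*} (G : Type*) [CommRing A] [CommRing B] [IsDomain B]
    [Algebra A B] [FaithfulSMul A B] [Group G] [MulSemiringAction G B] [Algebra.IsInvariant A B G]
    [SMulCommClass G A B] {a b : A}
    (h : algebraMap A B a ∣ algebraMap A B b) : a ∣ b := by
  obtain ⟨c, hc⟩ := h
  have hinj := FaithfulSMul.algebraMap_injective A B
  by_cases ha : a = 0
  · subst ha
    rw [map_zero, zero_mul, map_eq_zero_iff _ hinj] at hc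
    rw [hc]
  have ha' : algebraMap A B a ≠ 0 := by rwa [Ne, map_eq_zero_iff _ hinj]
  obtain ⟨d, rfl⟩ := Algebra.IsInvariant.isInvariant (A := A) (G := G) c fun g => by
    -- The quotient `c` is invariant, since `a` and `b` are.
    apply mul_left_cancel₀ ha'
    rw [← hc, ← smul_algebraMap g a, ← smul_mul', ← hc, smul_algebraMap]
  exact ⟨d, hinj (by rw [hc, map_mul])⟩

/-- `x ∈ B` is a totally ramified uniformizer over the prime `p` of `A`, and it generates an
extension that is unramified outside `p`: `x` is associated to its conjugates and to its differences
with them, and `p` is associated to `x ^ |G|`. -/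
structure IsTotallyRamified (G : Type*) {A B : Type*} [CommRing A] [CommRing B]
    [Algebra A B] [Group G] [MulSemiringAction G B] (p : A) (x : B) : Prop where
  prime : Prime p
  smul : ∀ τ : G, Associated (τ • x) x
  sub_smul : ∀ τ : G, τ ≠ 1 → Associated (x - τ • x) x
  map : Associated (algebraMap A B p) (x ^ Nat.card G)

namespace IsTotallyRamified

variable {p : A} {x : B}

theorem ne_zero [Finite G] [FaithfulSMul A B] (h : IsTotallyRamified G p x) : x ≠ 0 := by
  rintro rfl
  have := h.map
  rw [zero_pow Nat.card_pos.ne', associated_zero_iff_eq_zero,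
    map_eq_zero_iff _ (FaithfulSMul.algebraMap_injective A B)] at this
  exact h.prime.ne_zero this

section

variable [IsDomain B] [FaithfulSMul A B] [Algebra.IsInvariant A B G] [SMulCommClass G A B]

theorem not_isUnit (h : IsTotallyRamified G p x) : ¬ IsUnit x := fun hu => by
  have h1 : IsUnit (algebraMap A B p) := (h.map.isUnit_iff).2 (hu.pow _)
  refine h.prime.not_isUnit (isUnit_iff_dvd_one.2 (dvd_of_algebraMap_dvd G (B := B) ?_))
  rw [map_one]
  exact h1.dvd

/-- The ideal `(x)` contracts to `(p)`. -/
theorem dvd_of_dvd_algebraMap (h : IsTotallyRamified G p x) {a : A}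
    (ha : x ∣ algebraMap A B a) : p ∣ a := by
  refine h.prime.dvd_of_dvd_pow (n := Nat.card G) (dvd_of_algebraMap_dvd G (B := B) ?_)
  rw [map_pow]
  exact h.map.dvd.trans (pow_dvd_pow_of_dvd ha _)

end

end IsTotallyRamified

/-! ### Lagrange interpolation at the conjugates of an element -/

variable [Fintype G]

/-- `∏_{τ ≠ 1} (X - τ • x)`: the cofactor of `X - x` in the characteristic polynomial of `x`. -/
def cofactor (G : Type*) {B : Type*} [CommRing B] [Group G] [Fintype G] [MulSemiringAction G B]
    (x : B) : B[X] :=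
  open Classical in ∏ τ ∈ Finset.univ.erase (1 : G), (X - C (τ • x))

theorem natDegree_cofactor [IsDomain B] (x : B) : (cofactor G x).natDegree = Fintype.card G - 1 := by
  classical
  rw [cofactor, natDegree_finsetProd_X_sub_C_eq_card, Finset.card_erase_of_mem (Finset.mem_univ _),
    Finset.card_univ]

theorem eval_smul_cofactor [DecidableEq G] (x : B) (σ : G) :
    ((cofactor G x).map (MulSemiringAction.toRingHom G B σ)).eval x =
      if σ = 1 then (cofactor G x).eval x else 0 := by
  split_ifs with h
  · subst h
    congr 1
    ext n
    simp
  · simp only [cofactor, Polynomial.map_prod, eval_prod]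
    refine Finset.prod_eq_zero (i := σ⁻¹) (by simpa using h) ?_
    simp

/-- Lagrange interpolation at the conjugates of `x`: `Σ_σ σ(y) Q^σ(x) = y Q(x)`, where `Q` is the
cofactor of `X - x`, sorted by powers of `x`. The coefficients are traces of multiples of `y`. -/
theorem eval_cofactor_mul [IsDomain B] (x y : B) :
    (cofactor G x).eval x * y =
      ∑ i ∈ Finset.range (Fintype.card G), (∑ σ : G, σ • (y * (cofactor G x).coeff i)) * x ^ i := by
  classical
  have hdeg : (cofactor G x).natDegree < Fintype.card G := by
    rw [natDegree_cofactor]; have := Fintype.card_pos (α := G); omega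
  calc (cofactor G x).eval x * y
      = ∑ σ : G, (σ • y) * ((cofactor G x).map (MulSemiringAction.toRingHom G B σ)).eval x := by
        simp [eval_smul_cofactor, mul_comm]
    _ = ∑ σ : G, ∑ i ∈ Finset.range (Fintype.card G),
          (σ • (y * (cofactor G x).coeff i)) * x ^ i := by
        refine Finset.sum_congr rfl fun σ _ => ?_
        rw [eval_eq_sum_range' (natDegree_map_le.trans_lt hdeg), Finset.mul_sum]
        refine Finset.sum_congr rfl fun i _ => ?_
        simp [smul_mul', mul_assoc]
    _ = _ := by
        rw [Finset.sum_comm]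
        simp [Finset.sum_mul]

theorem exists_algebraMap_eq_sum_smul [Algebra.IsInvariant A B G] (y : B) :
    ∃ a : A, algebraMap A B a = ∑ σ : G, σ • y := by
  refine Algebra.IsInvariant.isInvariant (G := G) _ fun g => ?_
  rw [Finset.smul_sum]
  simp_rw [smul_smul]
  exact Fintype.sum_bijective (g * ·) (Group.mulLeft_bijective g) _ _ fun _ => rfl

theorem exists_algebraMap_eq_prod_smul [Algebra.IsInvariant A B G] (y : B) :
    ∃ a : A, algebraMap A B a = ∏ σ : G, σ • y := by
  refine Algebra.IsInvariant.isInvariant (G := G) _ fun g => ?_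
  rw [Finset.smul_prod']
  simp_rw [smul_smul]
  exact Fintype.prod_bijective (g * ·) (Group.mulLeft_bijective g) _ _ fun _ => rfl

/-! ### Invariant principal ideals -/

namespace IsTotallyRamified

variable {p : A} {x : B}

theorem associated_eval_cofactor (h : IsTotallyRamified G p x) :
    Associated ((cofactor G x).eval x) (x ^ (Fintype.card G - 1)) := by
  classical
  rw [cofactor, eval_prod, ← Finset.card_univ,
    ← Finset.card_erase_of_mem (Finset.mem_univ (1 : G)), ← Finset.prod_const]
  refine Associated.prod _ _ _ fun τ hτ => ?_
  simpa using h.sub_smul τ (Finset.ne_of_mem_erase hτ)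

variable [IsDomain B] [FaithfulSMul A B] [Algebra.IsInvariant A B G] [SMulCommClass G A B]

/-- An `A`-combination of `1, x, …, x ^ (n - 1)`, with `n ≤ |G|`, that is divisible by `x ^ n` has
its coefficients divisible by `p`: the valuations at `x` of its terms are distinct modulo `|G|`. -/
theorem dvd_of_pow_dvd_sum (h : IsTotallyRamified G p x) (a : ℕ → A) (n : ℕ)
    (hn : n ≤ Nat.card G) (hd : x ^ n ∣ ∑ i ∈ Finset.range n, algebraMap A B (a i) * x ^ i) :
    ∀ i < n, p ∣ a i := by
  intro i
  induction i using Nat.strong_induction_on with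
  | _ i ih =>
  intro hi
  have h1 : x ^ (i + 1) ∣ ∑ j ∈ Finset.range n, algebraMap A B (a j) * x ^ j :=
    (pow_dvd_pow _ hi).trans hd
  rw [← Finset.add_sum_erase _ _ (Finset.mem_range.2 hi)] at h1
  have h2 : x ^ (i + 1) ∣ ∑ j ∈ (Finset.range n).erase i, algebraMap A B (a j) * x ^ j := by
    refine Finset.dvd_sum fun j hj => ?_
    rw [Finset.mem_erase, Finset.mem_range] at hj
    rcases lt_or_gt_of_ne hj.1 with hlt | hgt
    · obtain ⟨b, hb⟩ := ih j hlt hj.2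
      rw [hb, map_mul, mul_assoc]
      exact (pow_dvd_pow x (by omega)).trans (h.map.symm.dvd.mul_right _)
    · exact (pow_dvd_pow _ hgt).mul_left _
  have h3 := (dvd_add_left h2).1 h1
  rw [pow_succ', mul_dvd_mul_iff_right (pow_ne_zero _ h.ne_zero)] at h3
  exact h.dvd_of_dvd_algebraMap h3

/-- The residue ring at `x` is no larger than the one at `p`: after division by `Q(x)`, every `y` is
`x ^ (1 - |G|)` times an `A`-combination of `1, x, …, x ^ (|G| - 1)`, and all its coefficients but the
last are divisible by `p`. -/
theorem exists_dvd_sub (h : IsTotallyRamified G p x) (y : B) :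
    ∃ a : A, x ∣ y - algebraMap A B a := by
  obtain ⟨u, hu⟩ := h.associated_eval_cofactor.symm
  choose a ha using fun i => exists_algebraMap_eq_sum_smul (A := A) (G := G)
    ((↑u⁻¹ * y) * (cofactor G x).coeff i)
  have key := eval_cofactor_mul (G := G) x (↑u⁻¹ * y)
  obtain ⟨m, hm⟩ : ∃ m, Fintype.card G = m + 1 := Nat.exists_eq_succ_of_ne_zero Fintype.card_ne_zero
  have hm' : Nat.card G = m + 1 := by rw [Nat.card_eq_fintype_card, hm]
  simp_rw [← ha] at key
  rw [← hu, hm, Nat.add_sub_cancel, mul_assoc, Units.mul_inv_cancel_left,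
    Finset.sum_range_succ] at key
  have h1 : ∀ i < m, p ∣ a i := by
    refine h.dvd_of_pow_dvd_sum a m (by omega) ?_
    rw [← sub_eq_iff_eq_add] at key
    rw [← key]
    exact dvd_sub (dvd_mul_right _ _) (dvd_mul_left _ _)
  have h2 : x ^ (m + 1) ∣ ∑ i ∈ Finset.range m, algebraMap A B (a i) * x ^ i := by
    refine Finset.dvd_sum fun i hi => ?_
    obtain ⟨b, hb⟩ := h1 i (Finset.mem_range.1 hi)
    rw [hb, map_mul, mul_assoc, ← hm']
    exact h.map.symm.dvd.mul_right _
  refine ⟨a m, ?_⟩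
  rw [← sub_eq_iff_eq_add, mul_comm _ (x ^ m), ← mul_sub] at key
  rw [← key, pow_succ, mul_dvd_mul_iff_left (pow_ne_zero _ h.ne_zero)] at h2
  exact h2

theorem prime_uniformizer (h : IsTotallyRamified G p x) : Prime x := by
  refine ⟨h.ne_zero, h.not_isUnit, fun y z hyz => ?_⟩
  obtain ⟨a, ha⟩ := h.exists_dvd_sub y
  obtain ⟨b, hb⟩ := h.exists_dvd_sub z
  have key : x ∣ algebraMap A B (a * b) := by
    have : algebraMap A B (a * b) =
        y * z - (y * (z - algebraMap A B b) + (y - algebraMap A B a) * algebraMap A B b) := by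
      rw [map_mul]; ring
    rw [this]
    exact dvd_sub hyz (dvd_add (hb.mul_left _) (ha.mul_right _))
  have hxp : x ∣ algebraMap A B p := (dvd_pow_self x Nat.card_pos.ne').trans h.map.symm.dvd
  refine (h.prime.dvd_or_dvd (h.dvd_of_dvd_algebraMap key)).imp (fun h' => ?_) (fun h' => ?_)
  · exact (dvd_iff_dvd_of_dvd_sub ha).2 (hxp.trans (map_dvd _ h'))
  · exact (dvd_iff_dvd_of_dvd_sub hb).2 (hxp.trans (map_dvd _ h'))

/-- An invariant principal ideal is, up to a power of the ramified prime `x`, extended from `A`.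
Traces of multiples of the generator `y` lie in the contraction `(a)` of the ideal to `A`. By
`eval_cofactor_mul`, `a` therefore divides `Q(x) y`, so `a / y` divides `Q(x)`, the derivative at `x`
of the characteristic polynomial of `x`, which is associated to a power of the prime `x`. -/
theorem exists_associated_pow_mul [IsPrincipalIdealRing A]
    (h : IsTotallyRamified G p x) {y : B} (hy : y ≠ 0) (hinv : ∀ τ : G, Associated (τ • y) y) :
    ∃ (a : A) (i : ℕ), a ≠ 0 ∧ Associated (algebraMap A B a) (x ^ i * y) := by
  obtain ⟨a, ha⟩ := IsPrincipalIdealRing.principal ((Ideal.span {y}).comap (algebraMap A B))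
  have ha' : ∀ b : A, y ∣ algebraMap A B b ↔ a ∣ b := fun b => by
    rw [← Ideal.mem_span_singleton, ← Ideal.mem_comap, ha]
    exact Ideal.mem_span_singleton
  obtain ⟨c, hc⟩ := (ha' a).2 dvd_rfl
  have h1 : algebraMap A B a ∣ (cofactor G x).eval x * y := by
    rw [eval_cofactor_mul]
    refine Finset.dvd_sum fun i _ => Dvd.dvd.mul_right ?_ _
    obtain ⟨b, hb⟩ := exists_algebraMap_eq_sum_smul (A := A) (G := G) (y * (cofactor G x).coeff i)
    rw [← hb]
    refine map_dvd _ ((ha' b).1 ?_)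
    rw [hb]
    refine Finset.dvd_sum fun σ _ => ?_
    rw [smul_mul']
    exact (hinv σ).symm.dvd.mul_right _
  rw [hc, mul_comm, mul_dvd_mul_iff_right hy] at h1
  obtain ⟨i, -, hi⟩ := (dvd_prime_pow h.prime_uniformizer _).1
    (h1.trans h.associated_eval_cofactor.dvd)
  refine ⟨a, i, ?_, ?_⟩
  · rintro rfl
    rw [map_zero, eq_comm, mul_eq_zero, or_iff_right hy] at hc
    rw [hc] at hi
    exact pow_ne_zero _ h.ne_zero ((associated_zero_iff_eq_zero _).1 hi.symm)
  · rw [hc, mul_comm]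
    exact hi.mul_right y

/-- A power of `x` with exponent less than `|G|` is associated to an element of `A` only if the
exponent vanishes. -/
theorem eq_zero_of_associated_pow (h : IsTotallyRamified G p x) {a : A} {n : ℕ}
    (hn : n < Nat.card G) (ha : Associated (algebraMap A B a) (x ^ n)) : n = 0 := by
  by_contra hn0
  have h1 := h.dvd_of_dvd_algebraMap ((dvd_pow_self x hn0).trans ha.symm.dvd)
  have h2 : x ^ Nat.card G ∣ x ^ n := h.map.symm.dvd.trans ((_root_.map_dvd _ h1).trans ha.dvd)
  have := (pow_dvd_pow_iff h.ne_zero h.not_isUnit).1 h2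
  omega

end IsTotallyRamified

end InvariantIdeal
end

noncomputable section

namespace InvariantIdeal

/-! ### Hilbert's Theorem 90 for domains -/

/-- Hilbert's Theorem 90 for a finite cyclic group acting on a domain: `y` is a nonzero value of
`∑ i, (∏_{j < i} σ ^ j η) σ ^ i`, a combination of distinct characters. -/
theorem exists_mul_smul_eq {B G : Type*} [CommRing B] [IsDomain B] [Group G] [Fintype G]
    [MulSemiringAction G B] [FaithfulSMul G B] {σ : G} (hσ : ∀ τ : G, τ ∈ Subgroup.zpowers σ)
    {η : B} (hη : ∏ τ : G, τ • η = 1) : ∃ y : B, y ≠ 0 ∧ η * σ • y = y := by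
  classical
  have hinj : Set.InjOn (σ ^ ·) (Finset.range (orderOf σ) : Set ℕ) := by
    rw [Finset.coe_range]; exact pow_injOn_Iio_orderOf
  have hprod : ∏ j ∈ Finset.range (orderOf σ), σ ^ j • η = 1 := by
    rw [← hη, ← IsCyclic.image_range_orderOf hσ, Finset.prod_image hinj]
  let e : ℕ → B := fun i => ∏ j ∈ Finset.range i, σ ^ j • η
  have he : ∀ i, e (i + 1) = η * σ • e i := fun i => by
    simp only [e, Finset.prod_range_succ', Finset.smul_prod', smul_smul, ← pow_succ', pow_zero,
      one_smul, mul_comm]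
  let χ : Fin (orderOf σ) → B →* B := fun i => MulSemiringAction.toRingHom G B (σ ^ (i : ℕ))
  have hχ : Function.Injective χ := fun i j hij => Fin.ext <| hinj (by simp) (by simp) <|
    eq_of_smul_eq_smul fun b : B => DFunLike.congr_fun hij b
  obtain ⟨z, hz⟩ : ∃ z, ∑ i ∈ Finset.range (orderOf σ), e i * σ ^ i • z ≠ 0 := by
    by_contra! hall
    have hli := Fintype.linearIndependent_iff.1
      ((linearIndependent_monoidHom B B).comp χ hχ) (fun i => e i) (funext fun z => by
        rw [Finset.sum_apply]
        exact (Fin.sum_univ_eq_sum_range (fun i => e i * σ ^ i • z) _).trans (hall z))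
    exact one_ne_zero (α := B) (by simpa [e] using hli ⟨0, orderOf_pos σ⟩)
  refine ⟨_, hz, ?_⟩
  have hshift : η * σ • ∑ i ∈ Finset.range (orderOf σ), e i * σ ^ i • z =
      ∑ i ∈ Finset.range (orderOf σ), e (i + 1) * σ ^ (i + 1) • z := by
    rw [Finset.smul_sum, Finset.mul_sum]
    refine Finset.sum_congr rfl fun i _ => ?_
    rw [smul_mul', smul_smul, ← pow_succ', he, mul_assoc]
  -- The sum is cyclic: its last term, shifted once more, is the first one.
  have hends : e (orderOf σ) * σ ^ orderOf σ • z = e 0 * σ ^ 0 • z := by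
    simp [e, hprod, pow_orderOf_eq_one]
  rw [hshift]
  exact add_right_cancel (b := e 0 * σ ^ 0 • z)
    ((Finset.sum_range_succ' (fun i => e i * σ ^ i • z) _).symm.trans
      ((Finset.sum_range_succ _ _).trans (by rw [hends])))

/-! ### Units of the form `y / σ(y)` -/

section Units

/-- `(x / σ(x)) ^ |G|` is the quotient by its conjugate of the unit `x ^ |G| / p`. -/
theorem IsTotallyRamified.pow_card_mem_range {A B G : Type*} [CommRing A] [CommRing B] [IsDomain B]
    [Algebra A B] [FaithfulSMul A B] [Group G] [MulSemiringAction G B] [SMulCommClass G A B]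
    {p : A} {x : B} {σ : G} {φ : Bˣ →* Bˣ} {w : Bˣ} (h : IsTotallyRamified G p x)
    (hφ : ∀ u : Bˣ, (φ u : B) = σ • (u : B)) (hw : σ • x * w = x) :
    w ^ Nat.card G ∈ (MonoidHom.id Bˣ / φ).range := by
  obtain ⟨s, hs⟩ := h.map
  refine ⟨s, ?_⟩
  rw [MonoidHom.div_apply, MonoidHom.id_apply, div_eq_iff_eq_mul, Units.ext_iff]
  have hp0 : algebraMap A B p ≠ 0 := by
    rw [Ne, map_eq_zero_iff _ (FaithfulSMul.algebraMap_injective A B)]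
    exact h.prime.ne_zero
  apply mul_left_cancel₀ hp0
  have h1 : algebraMap A B p * σ • (s : B) = (σ • x) ^ Nat.card G := by
    rw [← smul_pow', ← hs, smul_mul', smul_algebraMap]
  rw [hs, Units.val_mul, Units.val_pow_eq_pow_val, hφ, mul_left_comm, h1, ← mul_pow, mul_comm, hw]

variable {A B G : Type*} [CommRing A] [CommRing B] [IsDomain B] [Algebra A B] [FaithfulSMul A B]
  [Group G] [Finite G] [MulSemiringAction G B] [Algebra.IsInvariant A B G] [SMulCommClass G A B]
  {p : A} {x : B} {σ : G} {φ : Bˣ →* Bˣ} {w : Bˣ}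

/-- If `p` is associated to `x ^ N` with `N` at least `|G|`, then `|G| = N`, since the norm of `x`
is a nonunit that divides the prime `p`. -/
theorem card_eq_of_associated_pow (hp : Prime p) (hx : ∀ τ : G, Associated (τ • x) x) {N : ℕ}
    (hN : Nat.card G ≤ N) (h : Associated (algebraMap A B p) (x ^ N)) : Nat.card G = N := by
  have := Fintype.ofFinite G
  have := (FaithfulSMul.algebraMap_injective A B).isDomain (algebraMap A B)
  obtain ⟨c, hc⟩ := exists_algebraMap_eq_prod_smul (A := A) (G := G) x
  have hc' : Associated (algebraMap A B c) (x ^ Nat.card G) := by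
    rw [hc, Nat.card_eq_fintype_card, ← Finset.card_univ, ← Finset.prod_const]
    exact Associated.prod _ _ _ fun τ _ => hx τ
  have hunit : ∀ a : A, IsUnit (algebraMap A B a) → IsUnit a := fun a ha =>
    isUnit_iff_dvd_one.2 <| dvd_of_algebraMap_dvd (B := B) G <| by
      rw [map_one]; exact ha.dvd
  have hxu : ¬ IsUnit x := fun hu => hp.not_isUnit (hunit p (h.isUnit_iff.2 (hu.pow _)))
  have hx0 : x ≠ 0 := by
    rintro rfl
    rw [zero_pow (Nat.card_pos.trans_le hN).ne', associated_zero_iff_eq_zero,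
      map_eq_zero_iff _ (FaithfulSMul.algebraMap_injective A B)] at h
    exact hp.ne_zero h
  have hcu : ¬ IsUnit c := fun hu =>
    hxu ((isUnit_pow_iff Nat.card_pos.ne').1 (hc'.isUnit_iff.1 (hu.map _)))
  have hcp : c ∣ p := dvd_of_algebraMap_dvd (B := B) G
    (hc'.dvd.trans ((pow_dvd_pow x hN).trans h.symm.dvd))
  have hpc : p ∣ c := (hp.irreducible.dvd_iff.1 hcp).resolve_left hcu |>.dvd
  have := (pow_dvd_pow_iff hx0 hxu).1 (h.symm.dvd.trans ((_root_.map_dvd _ hpc).trans hc'.dvd))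
  omega


/-- A unit `η = y / σ(y)` is a power of `x / σ(x)` times `δ / σ(δ)` for a unit `δ`. -/
theorem IsTotallyRamified.exists_eq_pow_mul [IsPrincipalIdealRing A]
    (h : IsTotallyRamified G p x) (hσ : ∀ τ : G, τ ∈ Subgroup.zpowers σ)
    (hφ : ∀ u : Bˣ, (φ u : B) = σ • (u : B)) (hw : σ • x * w = x)
    (η : Bˣ) {y : B} (hy : y ≠ 0) (hη : η * σ • y = y) :
    ∃ ℓ < Nat.card G, ∃ κ ∈ (MonoidHom.id Bˣ / φ).range, η = w ^ ℓ * κ := by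
  have := Fintype.ofFinite G
  have hpow : ∀ n : ℕ, Associated (σ ^ n • y) y := fun n => by
    induction n with
    | zero => simp
    | succ n ih =>
      rw [pow_succ, mul_smul]
      refine Associated.trans ?_ ih
      refine ⟨Units.map (MulSemiringAction.toRingHom G B (σ ^ n)).toMonoidHom η, ?_⟩
      conv_rhs => rw [← hη]
      rw [smul_mul', mul_comm]
      rfl
  have hinv : ∀ τ : G, Associated (τ • y) y := fun τ => by
    obtain ⟨n, rfl⟩ := (mem_powers_iff_mem_zpowers).2 (hσ τ)
    exact hpow n
  obtain ⟨a, i, ha, v, hv⟩ := h.exists_associated_pow_mul hy hinv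
  have ha0 : algebraMap A B a ≠ 0 := by
    rwa [Ne, map_eq_zero_iff _ (FaithfulSMul.algebraMap_injective A B)]
  have key : w ^ i * η * φ v = v := by
    rw [Units.ext_iff]
    apply mul_left_cancel₀ ha0
    have h1 : algebraMap A B a * σ • (v : B) = (σ • x) ^ i * σ • y := by
      rw [← smul_algebraMap σ a, ← smul_mul', hv, smul_mul', smul_pow']
    rw [hv, Units.val_mul, Units.val_mul, Units.val_pow_eq_pow_val, hφ, mul_left_comm, h1,
      mul_mul_mul_comm, ← mul_pow, mul_comm (w : B), hw, hη]
  -- Thus `η = w ^ (-i) * (v / φ v)`; the exponent is now reduced modulo `|G|`.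
  have hN : (0 : ℤ) < Nat.card G := by exact_mod_cast Nat.card_pos
  obtain ⟨ℓ, hℓ⟩ : ∃ ℓ : ℕ, (ℓ : ℤ) = -(i : ℤ) % Nat.card G :=
    ⟨_, Int.toNat_of_nonneg (Int.emod_nonneg _ hN.ne')⟩
  refine ⟨ℓ, ?_, (w ^ Nat.card G) ^ (-(i : ℤ) / Nat.card G) * (v / φ v),
    mul_mem (zpow_mem (h.pow_card_mem_range hφ hw) _) ⟨v, rfl⟩, ?_⟩
  · have := Int.emod_lt_of_pos (-(i : ℤ)) hN
    omega
  · rw [← mul_assoc, ← zpow_natCast w ℓ, ← zpow_natCast w (Nat.card G), ← zpow_mul, ← zpow_add,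
      hℓ, Int.emod_add_mul_ediv, zpow_neg, zpow_natCast,
      eq_inv_mul_iff_mul_eq, eq_div_iff_mul_eq', key]

/-- Below `|G|`, powers of `x / σ(x)` are distinct modulo the quotients `δ / σ(δ)`: a relation
makes a power of `x` associated to an element of `A`. -/
theorem IsTotallyRamified.eq_of_pow_mul_eq
    (h : IsTotallyRamified G p x) (hσ : ∀ τ : G, τ ∈ Subgroup.zpowers σ)
    (hφ : ∀ u : Bˣ, (φ u : B) = σ • (u : B)) (hw : σ • x * w = x)
    {m n : ℕ} (hm : m < Nat.card G) (hn : n < Nat.card G)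
    {κ μ : Bˣ} (hκ : κ ∈ (MonoidHom.id Bˣ / φ).range) (hμ : μ ∈ (MonoidHom.id Bˣ / φ).range)
    (heq : w ^ m * κ = w ^ n * μ) : m = n := by
  wlog hmn : n ≤ m generalizing m n κ μ
  · exact (this hn hm hμ hκ heq.symm (by omega)).symm
  obtain ⟨k, rfl⟩ := Nat.exists_eq_add_of_le hmn
  obtain ⟨γ, hγ⟩ : w ^ k ∈ (MonoidHom.id Bˣ / φ).range := by
    rw [pow_add, mul_assoc, mul_right_inj] at heq
    rw [eq_mul_inv_of_mul_eq heq]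
    exact mul_mem hμ (inv_mem hκ)
  rw [MonoidHom.div_apply, MonoidHom.id_apply] at hγ
  -- Since `x = w σ(x)` and `w ^ k = γ / φ γ`, the element `x ^ k / γ` is invariant.
  have hfix : σ • (x ^ k * (↑γ⁻¹ : B)) = x ^ k * (↑γ⁻¹ : B) := by
    rw [smul_mul', smul_pow', ← hφ, map_inv]
    conv_rhs => rw [← hw, mul_pow, ← Units.val_pow_eq_pow_val, ← hγ, mul_assoc, ← Units.val_mul]
    congr 2
    rw [div_mul_eq_mul_div, mul_inv_cancel, one_div]
  obtain ⟨a, ha⟩ := Algebra.IsInvariant.isInvariant (A := A) (G := G) (x ^ k * (↑γ⁻¹ : B))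
    fun τ => by
      have : Subgroup.zpowers σ ≤ MulAction.stabilizer G (x ^ k * (↑γ⁻¹ : B)) := by
        rw [Subgroup.zpowers_le]; exact hfix
      exact this (hσ τ)
  have := Fintype.ofFinite G
  have := h.eq_zero_of_associated_pow (a := a) (n := k) (by omega)
    (by rw [ha]; exact associated_mul_unit_left _ _ (Units.isUnit _))
  omega

end Units

end InvariantIdeal
end

noncomputable section
namespace Carlitz

/-! ### The Carlitz action -/

section Operator

variable {F : Type*} [Field F] [Finite F] {R S : Type*} [CommRing R] [Algebra F R]
  [Algebra F[X] R] [IsScalarTower F F[X] R] [CommRing S] [Algebra F S]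
  [Algebra F[X] S] [IsScalarTower F F[X] S]

theorem carlitz_C (c : F) (x : R) : carlitz F R (C c) x = algebraMap F R c * x := by
  simp [carlitz, Algebra.smul_def]

theorem carlitz_mul (a b : F[X]) (x : R) :
    carlitz F R (a * b) x = carlitz F R a (carlitz F R b x) := by
  rw [map_mul, Module.End.mul_apply]

/-- A property of pairs `(a, y)` holds for all `(a, C_a(x))` if it is stable under `F`-linear
combinations and under the step `(a, y) ↦ (T a, T y + y ^ q)`. -/
theorem carlitz_induction {x : R} {p : F[X] → R → Prop}
    (hC : ∀ c : F, p (C c) (algebraMap F R c * x))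
    (hadd : ∀ a b y z, p a y → p b z → p (a + b) (y + z))
    (hX : ∀ a y, p a y → p (X * a) (algebraMap F[X] R X * y + y ^ Nat.card F)) (a : F[X]) :
    p a (carlitz F R a x) := by
  induction a using Polynomial.induction_on with
  | C c => rw [carlitz_C]; exact hC c
  | add a b ha hb => rw [map_add, LinearMap.add_apply]; exact hadd _ _ _ _ ha hb
  | monomial n c h =>
    rw [pow_succ', mul_left_comm, carlitz_mul, carlitz_X]
    exact hX _ _ h

theorem map_carlitz (f : R →ₐ[F[X]] S) (a : F[X]) (x : R) :
    f (carlitz F R a x) = carlitz F S a (f x) := by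
  refine carlitz_induction (p := fun a y => f y = carlitz F S a (f x)) (fun c => ?_)
    (fun a b y z hy hz => ?_) (fun a y hy => ?_) a
  · rw [carlitz_C, map_mul, IsScalarTower.algebraMap_apply F F[X] R, AlgHom.commutes,
      ← IsScalarTower.algebraMap_apply F F[X] S]
  · rw [map_add, hy, hz, map_add, LinearMap.add_apply]
  · rw [map_add, map_mul, map_pow, AlgHom.commutes, hy, carlitz_mul, carlitz_X]

theorem dvd_carlitz (a : F[X]) (x : R) : x ∣ carlitz F R a x :=
  carlitz_induction (p := fun _ y => x ∣ y) (fun _ => dvd_mul_left _ _)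
    (fun _ _ _ _ => dvd_add)
    (fun _ _ hy => dvd_add (hy.mul_left _) (dvd_pow hy Nat.card_pos.ne')) a

theorem carlitz_eq_zero_of_dvd {a P : F[X]} {x : R} (hx : carlitz F R P x = 0) (h : P ∣ a) :
    carlitz F R a x = 0 := by
  obtain ⟨b, rfl⟩ := h
  rw [mul_comm, carlitz_mul, hx, map_zero]

/-- A `P`-torsion point `x` and `C_a(x)`, with `a` prime to `P`, divide each other: if `b a ≡ 1` modulo
`P`, then `x = C_b(C_a(x))`. -/
theorem associated_carlitz [IsDomain R] {a P : F[X]} {x : R} (hP : Prime P)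
    (hx : carlitz F R P x = 0) (h : ¬ P ∣ a) : Associated (carlitz F R a x) x := by
  refine associated_of_dvd_dvd ?_ (dvd_carlitz a x)
  obtain ⟨b, c, hbc⟩ := (hP.irreducible.coprime_iff_not_dvd.2 h).symm
  have : carlitz F R (b * a) x = x := by
    rw [eq_sub_of_add_eq hbc, map_sub, map_one, LinearMap.sub_apply,
      carlitz_eq_zero_of_dvd hx (dvd_mul_left P c), sub_zero, Module.End.one_apply]
  nth_rewrite 2 [← this]
  rw [carlitz_mul]
  exact dvd_carlitz b _

end Operator

/-! ### The Carlitz polynomials -/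

section Poly

variable (F : Type*) [Field F] [Finite F]

/-- The polynomial `C_a(X)` over `A = F[T]` whose evaluations are the values of `C_a`. -/
def carlitzPoly (a : F[X]) : F[X][X] := carlitz F F[X][X] a X

variable {F}

theorem aeval_carlitzPoly {R : Type*} [CommRing R] [Algebra F R]
    [Algebra F[X] R] [IsScalarTower F F[X] R] (a : F[X]) (x : R) :
    aeval x (carlitzPoly F a) = carlitz F R a x := by
  rw [carlitzPoly, map_carlitz, aeval_X]

theorem derivative_carlitzPoly (a : F[X]) : derivative (carlitzPoly F a) = C a := by
  have hq : ((Nat.card F : ℕ) : F[X][X]) = 0 := by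
    have := Fintype.ofFinite F
    rw [← map_natCast (algebraMap F F[X][X]), Nat.card_eq_fintype_card,
      FiniteField.cast_card_eq_zero, map_zero]
  refine carlitz_induction (p := fun a y => derivative y = C a) (fun c => ?_)
    (fun a b y z hy hz => ?_) (fun a y hy => ?_) a
  · rw [IsScalarTower.algebraMap_apply F F[X] F[X][X], algebraMap_eq, algebraMap_eq,
      derivative_C_mul, derivative_X, mul_one]
  · rw [derivative_add, hy, hz, C_add]
  · rw [algebraMap_eq, derivative_add, derivative_C_mul, hy, derivative_pow, C_eq_natCast, hq,
      zero_mul, zero_mul, add_zero, C_mul]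

theorem coeff_zero_carlitzPoly (a : F[X]) : (carlitzPoly F a).coeff 0 = 0 :=
  X_dvd_iff.1 (dvd_carlitz a X)

theorem coeff_one_carlitzPoly (a : F[X]) : (carlitzPoly F a).coeff 1 = a := by
  have := congrArg (coeff · 0) (derivative_carlitzPoly a)
  simpa [coeff_derivative] using this

theorem monic_carlitzPoly_and_natDegree {a : F[X]} (ha : a.Monic) :
    (carlitzPoly F a).Monic ∧ (carlitzPoly F a).natDegree = Nat.card F ^ a.natDegree := by
  have hq : 1 < Nat.card F := Finite.one_lt_card
  obtain ⟨n, hn⟩ : ∃ n, a.natDegree = n := ⟨_, rfl⟩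
  induction n generalizing a with
  | zero =>
    obtain rfl := eq_one_of_monic_natDegree_zero ha hn
    simp [carlitzPoly, monic_X]
  | succ n ih =>
    have hb : a.divX.natDegree = n := by rw [natDegree_divX_eq_natDegree_tsub_one, hn]; rfl
    have hbm : a.divX.Monic := by
      rw [Monic, leadingCoeff, hb, coeff_divX, ← hn]; exact ha
    obtain ⟨hm, hd⟩ := ih hbm hb
    rw [hb] at hd
    set f := carlitzPoly F a.divX with hf
    have hexp : carlitzPoly F a = (C X * f + C (C (a.coeff 0)) * X) + f ^ Nat.card F := by
      conv_lhs => rw [← X_mul_divX_add a]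
      rw [carlitzPoly, map_add, LinearMap.add_apply, carlitz_mul, carlitz_X, carlitz_C,
        IsScalarTower.algebraMap_apply F F[X] F[X][X], algebraMap_eq, algebraMap_eq, hf,
        carlitzPoly]
      ring
    have hdp : (f ^ Nat.card F).natDegree = Nat.card F ^ (n + 1) := by
      rw [hm.natDegree_pow, hd, pow_succ']
    have hlt : (C X * f + C (C (a.coeff 0)) * X).natDegree < (f ^ Nat.card F).natDegree := by
      refine lt_of_le_of_lt (natDegree_add_le_of_degree_le (n := Nat.card F ^ n)
        ((natDegree_C_mul_le _ _).trans hd.le) ((natDegree_C_mul_le _ _).trans ?_)) ?_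
      · rw [natDegree_X]; exact Nat.one_le_pow _ _ (by omega)
      · rw [hdp]; exact Nat.pow_lt_pow_right hq (Nat.lt_succ_self n)
    rw [hexp, hn, ← hdp]
    exact ⟨(hm.pow _).add_of_right (degree_lt_degree hlt),
      natDegree_add_eq_right_of_natDegree_lt hlt⟩

end Poly

end Carlitz
end

noncomputable section
namespace Carlitz

variable {F : Type*} [Field F] [Finite F] {P : F[X]}

/-! ### The cyclotomic function field as a splitting field -/

section Splitting

/-- The polynomial `C_P(X)` over `k`. -/
def torsionPoly (F : Type*) [Field F] [Finite F] (P : F[X]) : (RatFunc F)[X] :=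
  (carlitzPoly F P).map (algebraMap F[X] (RatFunc F))

theorem monic_torsionPoly (hP : P.Monic) : (torsionPoly F P).Monic :=
  (monic_carlitzPoly_and_natDegree hP).1.map _

theorem natDegree_torsionPoly (hP : P.Monic) :
    (torsionPoly F P).natDegree = Nat.card F ^ P.natDegree := by
  rw [torsionPoly, (monic_carlitzPoly_and_natDegree hP).1.natDegree_map,
    (monic_carlitzPoly_and_natDegree hP).2]

theorem separable_torsionPoly (hP : P ≠ 0) : (torsionPoly F P).Separable := by
  have h0 : algebraMap F[X] (RatFunc F) P ≠ 0 := by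
    rwa [Ne, map_eq_zero_iff _ (IsFractionRing.injective F[X] (RatFunc F))]
  refine ⟨0, C (algebraMap F[X] (RatFunc F) P)⁻¹, ?_⟩
  rw [torsionPoly, derivative_map, derivative_carlitzPoly, map_C, ← C_mul, inv_mul_cancel₀ h0,
    zero_mul, zero_add, C_1]

theorem aeval_torsionPoly {R : Type*} [CommRing R] [Algebra F R] [Algebra F[X] R]
    [IsScalarTower F F[X] R] [Algebra (RatFunc F) R] [IsScalarTower F[X] (RatFunc F) R] (x : R) :
    aeval x (torsionPoly F P) = carlitz F R P x := by
  rw [torsionPoly, aeval_map_algebraMap, aeval_carlitzPoly]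

theorem rootSet_torsionPoly (hP : P.Monic) :
    (torsionPoly F P).rootSet (KAlg F) = torsion F P := by
  ext x
  rw [mem_rootSet_of_ne (monic_torsionPoly hP).ne_zero, aeval_torsionPoly]
  rfl

theorem isSplittingField_torsionPoly (hP : P.Monic) :
    (torsionPoly F P).IsSplittingField (RatFunc F) (cyclotomicField F P) := by
  have := IntermediateField.adjoin_rootSet_isSplittingField
    (IsAlgClosed.splits ((torsionPoly F P).map (algebraMap (RatFunc F) (KAlg F))))
  rwa [rootSet_torsionPoly hP] at this

theorem finiteDimensional_cyclotomicField (hP : P.Monic) :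
    FiniteDimensional (RatFunc F) (cyclotomicField F P) :=
  have := isSplittingField_torsionPoly hP
  IsSplittingField.finiteDimensional _ (torsionPoly F P)

theorem isGalois_cyclotomicField (hP : P.Monic) :
    IsGalois (RatFunc F) (cyclotomicField F P) :=
  have := isSplittingField_torsionPoly hP
  IsGalois.of_separable_splitting_field (separable_torsionPoly hP.ne_zero)

end Splitting

/-- If `0` is a root of a separable monic polynomial, its linear coefficient is the product of the
negatives of the other roots. -/
theorem coeff_one_eq_prod_roots {K : Type*} [Field K] [DecidableEq K] {f : K[X]} (hm : f.Monic)
    (hs : f.Splits) (hsep : f.Separable) (h0 : f.coeff 0 = 0) :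
    f.coeff 1 = ∏ r ∈ f.roots.toFinset.erase 0, -r ∧
      (f.roots.toFinset.erase 0).card + 1 = f.natDegree := by
  have hnd : f.roots.Nodup := nodup_roots hsep
  have hf : f = ∏ r ∈ f.roots.toFinset, (X - C r) := by
    rw [Finset.prod, Multiset.toFinset_val, hnd.dedup]
    exact hs.eq_prod_roots_of_monic hm
  have h0m : (0 : K) ∈ f.roots.toFinset := by
    rw [Multiset.mem_toFinset, mem_roots hm.ne_zero, IsRoot, ← coeff_zero_eq_eval_zero, h0]
  refine ⟨?_, ?_⟩
  · conv_lhs => rw [hf, ← Finset.mul_prod_erase _ _ h0m, C_0, sub_zero, coeff_X_mul,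
      coeff_zero_eq_eval_zero, eval_prod]
    simp
  · rw [Finset.card_erase_add_one h0m, Multiset.toFinset_card_of_nodup hnd,
      hs.natDegree_eq_card_roots]

/-! ### The Galois action on the ring of integers -/

section Action

instance smulCommClass_gal :
    SMulCommClass Gal(cyclotomicField F P / RatFunc F) F[X] (cyclotomicField F P) :=
  ⟨fun σ a x => by
    rw [AlgEquiv.smul_def, AlgEquiv.smul_def, algebra_compatible_smul (RatFunc F) a x, map_smul,
      ← algebra_compatible_smul]⟩

theorem isInvariant_integers (hP : P.Monic) :
    Algebra.IsInvariant F[X] (integers F P) Gal(cyclotomicField F P / RatFunc F) := by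
  have := finiteDimensional_cyclotomicField hP
  have := isGalois_cyclotomicField hP
  have : IsFractionRing (integers F P) (cyclotomicField F P) :=
    integralClosure.isFractionRing_of_finite_extension (RatFunc F) (cyclotomicField F P)
  refine ⟨fun b hb => (Algebra.isInvariant_of_isGalois F[X] (RatFunc F) (cyclotomicField F P)
    (integers F P)).1 b fun σ => ?_⟩
  refine Eq.trans (Subtype.ext ?_) (hb σ)
  exact algebraMap_galRestrict_apply F[X] σ b

instance faithfulSMul_integers : FaithfulSMul F[X] (integers F P) := by
  rw [faithfulSMul_iff_algebraMap_injective]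
  refine Function.Injective.of_comp (f := algebraMap (integers F P) (cyclotomicField F P)) ?_
  rw [← RingHom.coe_comp, ← IsScalarTower.algebraMap_eq,
    IsScalarTower.algebraMap_eq F[X] (RatFunc F), RingHom.coe_comp]
  exact (algebraMap (RatFunc F) _).injective.comp (IsFractionRing.injective F[X] (RatFunc F))

theorem smul_carlitz (σ : Gal(cyclotomicField F P / RatFunc F)) (a : F[X]) (x : integers F P) :
    σ • carlitz F (integers F P) a x = carlitz F (integers F P) a (σ • x) :=
  map_carlitz (MulSemiringAction.toAlgHom F[X] (integers F P) σ) a x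

theorem coe_carlitz (a : F[X]) (x : integers F P) :
    ((carlitz F (integers F P) a x : integers F P) : cyclotomicField F P) =
      carlitz F (cyclotomicField F P) a x :=
  map_carlitz (integers F P).val a x

instance isScalarTower_KAlg : IsScalarTower F[X] (cyclotomicField F P) (KAlg F) :=
  IsScalarTower.of_algebraMap_eq fun _ => rfl

theorem coe_carlitz_cyclotomicField (a : F[X]) (x : cyclotomicField F P) :
    ((carlitz F (cyclotomicField F P) a x : cyclotomicField F P) : KAlg F) =
      carlitz F (KAlg F) a x :=
  map_carlitz (IsScalarTower.toAlgHom F[X] (cyclotomicField F P) (KAlg F)) a x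

end Action

/-- `Λ_P ∖ {0}` has `q ^ deg P - 1` elements, all of them integral, and the product of their
negatives is `P`, the linear coefficient of `C_P(X)`. -/
theorem exists_finset_torsion (hm : P.Monic) : ∃ S : Finset (integers F P),
    (∀ y, y ∈ S ↔ carlitz F (integers F P) P y = 0 ∧ y ≠ 0) ∧
    S.card = Nat.card F ^ P.natDegree - 1 ∧ algebraMap F[X] (integers F P) P = ∏ y ∈ S, -y := by
  classical
  have := isSplittingField_torsionPoly hm
  set f := (torsionPoly F P).map (algebraMap (RatFunc F) (cyclotomicField F P)) with hf
  have hfm : f.Monic := (monic_torsionPoly hm).map _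
  obtain ⟨h1, h2⟩ := coeff_one_eq_prod_roots hfm
    (IsSplittingField.splits (cyclotomicField F P) (torsionPoly F P))
    (separable_torsionPoly hm.ne_zero).map
    (by rw [hf, coeff_map, torsionPoly, coeff_map, coeff_zero_carlitzPoly, map_zero, map_zero])
  have hroot : ∀ r : cyclotomicField F P,
      r ∈ f.roots.toFinset ↔ carlitz F (cyclotomicField F P) P r = 0 := fun r => by
    rw [Multiset.mem_toFinset, mem_roots hfm.ne_zero, IsRoot, hf, eval_map_algebraMap,
      aeval_torsionPoly]
  have hinj : Function.Injective ((↑) : integers F P → cyclotomicField F P) :=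
    Subtype.val_injective
  have himg : ((f.roots.toFinset.erase 0).preimage (↑) hinj.injOn).image
      ((↑) : integers F P → cyclotomicField F P) = f.roots.toFinset.erase 0 := by
    rw [Finset.image_preimage, Finset.filter_true_of_mem]
    intro r hr
    have hr0 := (hroot r).1 (Finset.mem_of_mem_erase hr)
    refine ⟨⟨r, carlitzPoly F P, (monic_carlitzPoly_and_natDegree hm).1, ?_⟩, rfl⟩
    rw [← aeval_def, aeval_carlitzPoly, hr0]
  refine ⟨(f.roots.toFinset.erase 0).preimage (↑) hinj.injOn, fun y => ?_, ?_, ?_⟩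
  · rw [Finset.mem_preimage, Finset.mem_erase, hroot, ← coe_carlitz, and_comm, ne_eq, ne_eq,
      ZeroMemClass.coe_eq_zero, ZeroMemClass.coe_eq_zero]
  · rw [← Finset.card_image_of_injective _ hinj, himg, ← natDegree_torsionPoly hm, ← h2.trans
      (natDegree_map _), Nat.add_sub_cancel]
  · apply hinj
    rw [← himg, Finset.prod_image hinj.injOn, hf, coeff_map, torsionPoly, coeff_map,
      coeff_one_carlitzPoly, ← IsScalarTower.algebraMap_apply] at h1
    refine Eq.trans h1 ?_
    push_cast
    rfl

/-! ### Generators of the torsion module -/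

section Generator

/-- An integer `x` of `K_P` is a generator of the torsion module `Λ_P`. -/
structure IsGenerator (P : F[X]) (x : integers F P) : Prop where
  carlitz_eq_zero : carlitz F (integers F P) P x = 0
  exists_carlitz_eq : ∀ y : KAlg F, y ∈ torsion F P →
    ∃ a : F[X], ((carlitz F (integers F P) a x : cyclotomicField F P) : KAlg F) = y

theorem exists_isGenerator (hP : P.Monic) {lam : cyclotomicField F P}
    (hlam : IsPrimitiveTorsion F P (lam : KAlg F)) :
    ∃ x : integers F P, (x : cyclotomicField F P) = lam ∧ IsGenerator P x := by
  have h0 : carlitz F (cyclotomicField F P) P lam = 0 := by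
    apply Subtype.ext
    rw [coe_carlitz_cyclotomicField]
    exact hlam.1
  have hint : IsIntegral F[X] lam :=
    ⟨carlitzPoly F P, (monic_carlitzPoly_and_natDegree hP).1, by
      rw [← aeval_def, aeval_carlitzPoly, h0]⟩
  refine ⟨⟨lam, hint⟩, rfl, Subtype.ext ?_, fun y hy => ?_⟩
  · rw [coe_carlitz]; exact h0
  · obtain ⟨a, ha⟩ := hlam.2 y hy
    exact ⟨a, by rw [coe_carlitz, coe_carlitz_cyclotomicField, ← ha]⟩

namespace IsGenerator

variable {x : integers F P} (h : IsGenerator P x)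
include h

theorem exists_eq_carlitz {y : integers F P} (hy : carlitz F (integers F P) P y = 0) :
    ∃ a : F[X], carlitz F (integers F P) a x = y := by
  obtain ⟨a, ha⟩ := h.exists_carlitz_eq ((y : cyclotomicField F P) : KAlg F) (by
    change carlitz F (KAlg F) P _ = 0
    rw [← coe_carlitz_cyclotomicField, ← coe_carlitz, hy]; rfl)
  exact ⟨a, Subtype.ext (Subtype.ext ha)⟩

theorem exists_eq_carlitz_of_ne_zero {y : integers F P} (hy : carlitz F (integers F P) P y = 0)
    (hy0 : y ≠ 0) : ∃ a : F[X], ¬ P ∣ a ∧ carlitz F (integers F P) a x = y := by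
  obtain ⟨a, rfl⟩ := h.exists_eq_carlitz hy
  exact ⟨a, fun hd => hy0 (carlitz_eq_zero_of_dvd h.carlitz_eq_zero hd), rfl⟩

/-- Any two nonzero `P`-torsion points are associated in `O_P`. -/
theorem associated (hP : Prime P) {y : integers F P} (hy : carlitz F (integers F P) P y = 0)
    (hy0 : y ≠ 0) : Associated y x := by
  obtain ⟨a, ha, rfl⟩ := h.exists_eq_carlitz_of_ne_zero hy hy0
  exact associated_carlitz hP h.carlitz_eq_zero ha

theorem carlitz_smul_eq_zero (τ : Gal(cyclotomicField F P / RatFunc F)) :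
    carlitz F (integers F P) P (τ • x) = 0 := by
  rw [← smul_carlitz, h.carlitz_eq_zero, smul_zero]

/-- An automorphism is determined by the image of a generator of `Λ_P`. -/
theorem smul_injective : Function.Injective
    fun τ : Gal(cyclotomicField F P / RatFunc F) => τ • x := by
  intro τ ρ hτρ
  have key : ∀ y ∈ torsion F P, ∀ hy : y ∈ cyclotomicField F P, τ ⟨y, hy⟩ = ρ ⟨y, hy⟩ := by
    intro y hyt hy
    obtain ⟨a, ha⟩ := h.exists_carlitz_eq y hyt
    have hya : (⟨y, hy⟩ : cyclotomicField F P) = (carlitz F (integers F P) a x : integers F P) :=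
      Subtype.ext ha.symm
    rw [hya]
    have h1 : τ • carlitz F (integers F P) a x = ρ • carlitz F (integers F P) a x := by
      rw [smul_carlitz, smul_carlitz]; exact congrArg _ hτρ
    exact congrArg Subtype.val h1
  have : (τ : cyclotomicField F P →ₐ[RatFunc F] cyclotomicField F P) = ρ :=
    IntermediateField.algHom_ext_of_eq_adjoin _ rfl fun y hy => key y hy _
  exact AlgEquiv.ext fun y => DFunLike.congr_fun this y

end IsGenerator
end Generator
end Carlitz
end

noncomputable section
namespace Carlitz
open InvariantIdeal
variable {F : Type*} [Field F] [Finite F] {P : F[X]}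

/-! ### The Galois group of the cyclotomic function field -/

namespace IsGenerator

variable {x : integers F P}

theorem ne_zero (h : IsGenerator P x) (hm : P.Monic) (hP : Prime P) : x ≠ 0 := by
  rintro rfl
  obtain ⟨S, hS, hcard, -⟩ := exists_finset_torsion hm
  have hempty : S = ∅ := Finset.eq_empty_of_forall_notMem fun y hy => by
    obtain ⟨h1, h2⟩ := (hS y).1 hy
    obtain ⟨a, rfl⟩ := h.exists_eq_carlitz h1
    exact h2 (map_zero _)
  have hlt : 1 < Nat.card F ^ P.natDegree :=
    Nat.one_lt_pow hP.irreducible.natDegree_pos.ne' Finite.one_lt_card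
  rw [hempty, Finset.card_empty] at hcard
  omega

theorem associated_smul (h : IsGenerator P x) (hm : P.Monic) (hP : Prime P)
    (τ : Gal(cyclotomicField F P / RatFunc F)) : Associated (τ • x) x :=
  h.associated hP (h.carlitz_smul_eq_zero τ) ((smul_ne_zero_iff_ne τ).2 (h.ne_zero hm hP))

theorem associated_algebraMap (h : IsGenerator P x) (hm : P.Monic) (hP : Prime P) :
    Associated (algebraMap F[X] (integers F P) P) (x ^ (Nat.card F ^ P.natDegree - 1)) := by
  obtain ⟨S, hS, hcard, hprod⟩ := exists_finset_torsion hm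
  rw [hprod, ← hcard, ← Finset.prod_const]
  refine Associated.prod _ _ _ fun y hy => ?_
  obtain ⟨h1, h2⟩ := (hS y).1 hy
  exact (h.associated hP h1 h2).neg_left

/-- The orbit map of `x` embeds the Galois group into `Λ_P ∖ {0}`, so it has at most
`q ^ deg P - 1` elements; since `P` is prime, total ramification forces equality. -/
theorem card_gal (h : IsGenerator P x) (hm : P.Monic) (hP : Prime P) :
    Nat.card Gal(cyclotomicField F P / RatFunc F) = Nat.card F ^ P.natDegree - 1 := by
  have := finiteDimensional_cyclotomicField hm
  have := isInvariant_integers hm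
  refine card_eq_of_associated_pow hP (h.associated_smul hm hP) ?_ (h.associated_algebraMap hm hP)
  obtain ⟨S, hS, hcard, -⟩ := exists_finset_torsion hm
  rw [← hcard, ← Nat.card_eq_finsetCard]
  refine Nat.card_le_card_of_injective
    (fun τ => (⟨τ • x, (hS _).2 ⟨h.carlitz_smul_eq_zero τ,
      (smul_ne_zero_iff_ne τ).2 (h.ne_zero hm hP)⟩⟩ : S)) fun τ ρ hτρ => ?_
  exact h.smul_injective (congrArg Subtype.val hτρ)

theorem isTotallyRamified (h : IsGenerator P x) (hm : P.Monic) (hP : Prime P) :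
    IsTotallyRamified Gal(cyclotomicField F P / RatFunc F) P x where
  prime := hP
  smul := h.associated_smul hm hP
  sub_smul τ hτ := by
    refine h.associated hP ?_ ?_
    · rw [map_sub, h.carlitz_eq_zero, h.carlitz_smul_eq_zero, sub_zero]
    · rw [sub_ne_zero]
      intro hx
      exact hτ (h.smul_injective (by simpa using hx.symm))
  map := by
    rw [h.card_gal hm hP]
    exact h.associated_algebraMap hm hP

/-- The Galois group acts transitively on `Λ_P ∖ {0}`, by counting. -/
theorem exists_smul_eq (h : IsGenerator P x) (hm : P.Monic) (hP : Prime P) {y : integers F P}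
    (hy : carlitz F (integers F P) P y = 0) (hy0 : y ≠ 0) :
    ∃ σ : Gal(cyclotomicField F P / RatFunc F), σ • x = y := by
  have := finiteDimensional_cyclotomicField hm
  obtain ⟨S, hS, hcard, -⟩ := exists_finset_torsion hm
  let f : Gal(cyclotomicField F P / RatFunc F) → S := fun τ => ⟨τ • x, (hS _).2
    ⟨h.carlitz_smul_eq_zero τ, (smul_ne_zero_iff_ne τ).2 (h.ne_zero hm hP)⟩⟩
  have hf : Function.Bijective f := (Nat.bijective_iff_injective_and_card f).2
    ⟨fun τ ρ hτρ => h.smul_injective (congrArg Subtype.val hτρ), by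
      rw [h.card_gal hm hP, Nat.card_eq_finsetCard, hcard]⟩
  obtain ⟨σ, hσ⟩ := hf.2 ⟨y, (hS _).2 ⟨hy, hy0⟩⟩
  exact ⟨σ, congrArg Subtype.val hσ⟩

theorem not_dvd_of_carlitz_eq_smul (h : IsGenerator P x) (hm : P.Monic) (hP : Prime P) {a : F[X]}
    {τ : Gal(cyclotomicField F P / RatFunc F)} (ha : carlitz F (integers F P) a x = τ • x) :
    ¬ P ∣ a := fun hd => by
  rw [carlitz_eq_zero_of_dvd h.carlitz_eq_zero hd, eq_comm, smul_eq_zero_iff_eq] at ha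
  exact h.ne_zero hm hP ha

theorem pow_smul (σ : Gal(cyclotomicField F P / RatFunc F)) {g : F[X]}
    (hσ : σ • x = carlitz F (integers F P) g x) (n : ℕ) :
    σ ^ n • x = carlitz F (integers F P) (g ^ n) x := by
  induction n with
  | zero => simp
  | succ n ih => rw [pow_succ, mul_smul, hσ, smul_carlitz, ih, ← carlitz_mul, ← pow_succ']

/-- `C_a(x)` depends only on the class of `a` modulo `P`. -/
theorem carlitz_congr (h : IsGenerator P x) {a b : F[X]}
    (hab : Ideal.Quotient.mk (Ideal.span {P}) a = Ideal.Quotient.mk (Ideal.span {P}) b) :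
    carlitz F (integers F P) a x = carlitz F (integers F P) b x := by
  rw [Ideal.Quotient.eq, Ideal.mem_span_singleton] at hab
  rw [← sub_eq_zero, ← LinearMap.sub_apply, ← map_sub]
  exact carlitz_eq_zero_of_dvd h.carlitz_eq_zero hab

/-- The Galois group is generated by `σ_g` when `g` is a primitive root modulo `P`. -/
theorem mem_zpowers (h : IsGenerator P x) (hm : P.Monic) (hP : Prime P) {g : F[X]}
    (hg : IsPrimitiveRootMod P g) {σ : Gal(cyclotomicField F P / RatFunc F)}
    (hσ : σ • x = carlitz F (integers F P) g x) (τ : Gal(cyclotomicField F P / RatFunc F)) :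
    τ ∈ Subgroup.zpowers σ := by
  obtain ⟨a, ha⟩ := h.exists_eq_carlitz (h.carlitz_smul_eq_zero τ)
  obtain ⟨b, c, hbc⟩ := (hP.irreducible.coprime_iff_not_dvd.2
    (h.not_dvd_of_carlitz_eq_smul hm hP ha)).symm
  obtain ⟨u, hu, htop⟩ := hg
  have hmk : Ideal.Quotient.mk (Ideal.span {P}) a * Ideal.Quotient.mk (Ideal.span {P}) b = 1 := by
    rw [← map_mul, ← map_one (Ideal.Quotient.mk (Ideal.span {P})), Ideal.Quotient.eq,
      Ideal.mem_span_singleton, ← hbc]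
    exact ⟨-c, by ring⟩
  obtain ⟨j, hj⟩ : Units.mkOfMulEqOne _ _ hmk ∈ Subgroup.zpowers u := htop ▸ Subgroup.mem_top _
  obtain ⟨n, rfl | rfl⟩ := Int.eq_nat_or_neg j
  · refine ⟨n, h.smul_injective ?_⟩
    change σ ^ (n : ℤ) • x = τ • x
    rw [zpow_natCast, pow_smul σ hσ, ← ha]
    refine h.carlitz_congr ?_
    rw [map_pow, ← hu, ← Units.val_pow_eq_pow_val, ← zpow_natCast]
    exact congrArg Units.val hj
  -- For a negative exponent, `a * g ^ n ≡ 1` modulo `P`, so `σ ^ n τ` fixes `x`.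
  · refine ⟨-(n : ℤ), h.smul_injective ?_⟩
    change σ ^ (-(n : ℤ)) • x = τ • x
    rw [zpow_neg, zpow_natCast, inv_smul_eq_iff, ← ha, smul_carlitz, pow_smul σ hσ, ← carlitz_mul]
    have h1 : x = carlitz F (integers F P) 1 x := by simp
    conv_lhs => rw [h1]
    refine h.carlitz_congr ?_
    change u ^ (-(n : ℤ)) = _ at hj
    have h2 := congrArg Units.val (mul_inv_eq_one.2 hj.symm)
    rw [zpow_neg, inv_inv, zpow_natCast] at h2
    rw [map_mul, map_pow, ← hu, map_one]
    exact h2.symm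

end IsGenerator

end Carlitz
end

theorem mainTheorem2 (F : Type*) [Field F] [Finite F] (P : Polynomial F)
    (hP : P.Monic) (hP' : Prime P)
    (g : Polynomial F) (hg : Carlitz.IsPrimitiveRootMod P g)
    (lam : Carlitz.cyclotomicField F P)
    (hlam : Carlitz.IsPrimitiveTorsion F P (lam : Carlitz.KAlg F)) :
    (∃! σ : Gal(Carlitz.cyclotomicField F P / RatFunc F),
      σ lam = Carlitz.carlitz F (Carlitz.cyclotomicField F P) g lam) ∧
    ∀ σ : Gal(Carlitz.cyclotomicField F P / RatFunc F),
      σ lam = Carlitz.carlitz F (Carlitz.cyclotomicField F P) g lam →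
      ∀ ε : (Carlitz.integers F P)ˣ,
        Algebra.norm (RatFunc F)
          ((ε : Carlitz.integers F P) : Carlitz.cyclotomicField F P) = 1 →
        ∃ ℓ : ℕ, ∃ κ : (Carlitz.integers F P)ˣ,
          ℓ ≤ Nat.card F ^ P.natDegree - 2 ∧
          κ ∈ Carlitz.quotientUnits F P σ ∧
          ((ε : Carlitz.integers F P) : Carlitz.cyclotomicField F P) =
            (lam / Carlitz.carlitz F (Carlitz.cyclotomicField F P) g lam) ^ ℓ *
              ((κ : Carlitz.integers F P) : Carlitz.cyclotomicField F P) ∧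
          ∀ (ℓ' : ℕ) (κ' : (Carlitz.integers F P)ˣ),
            ℓ' ≤ Nat.card F ^ P.natDegree - 2 →
            κ' ∈ Carlitz.quotientUnits F P σ →
            ((ε : Carlitz.integers F P) : Carlitz.cyclotomicField F P) =
              (lam / Carlitz.carlitz F (Carlitz.cyclotomicField F P) g lam) ^ ℓ' *
                ((κ' : Carlitz.integers F P) : Carlitz.cyclotomicField F P) →
            ℓ' = ℓ ∧ κ' = κ := by
  obtain ⟨x, rfl, h⟩ := Carlitz.exists_isGenerator hP hlam
  have hfin := Carlitz.finiteDimensional_cyclotomicField hP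
  have hgal := Carlitz.isGalois_cyclotomicField hP
  have hinvt := Carlitz.isInvariant_integers hP
  have hram := h.isTotallyRamified hP hP'
  have hcard := h.card_gal hP hP'
  have hlt : 1 < Nat.card F ^ P.natDegree :=
    Nat.one_lt_pow hP'.irreducible.natDegree_pos.ne' Finite.one_lt_card
  have hiff : ∀ σ : Gal(Carlitz.cyclotomicField F P / RatFunc F),
      σ x = Carlitz.carlitz F (Carlitz.cyclotomicField F P) g x ↔
        σ • x = Carlitz.carlitz F (Carlitz.integers F P) g x := fun σ => by
    rw [← Carlitz.coe_carlitz]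
    exact ⟨fun h => Subtype.ext h, fun h => congrArg Subtype.val h⟩
  have hgP : ¬ P ∣ g := fun hd => by
    obtain ⟨u, hu, -⟩ := hg
    have : Nontrivial (F[X] ⧸ Ideal.span {P}) := Ideal.Quotient.nontrivial_iff.2
      (Ideal.span_singleton_eq_top.not.2 hP'.not_isUnit)
    exact u.ne_zero (hu.trans (Ideal.Quotient.eq_zero_iff_dvd _ _ |>.2 hd))
  simp_rw [hiff]
  refine ⟨?_, fun σ hσ ε hε => ?_⟩
  · have hassoc := Carlitz.associated_carlitz hP' h.carlitz_eq_zero hgP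
    obtain ⟨σ, hσ⟩ := h.exists_smul_eq hP hP' (y := Carlitz.carlitz F (Carlitz.integers F P) g x)
      (by rw [← Carlitz.carlitz_mul, mul_comm, Carlitz.carlitz_mul, h.carlitz_eq_zero, map_zero])
      (hassoc.ne_zero_iff.2 (h.ne_zero hP hP'))
    exact ⟨σ, hσ, fun τ hτ => h.smul_injective (hτ.trans hσ.symm)⟩
  have hgen := h.mem_zpowers hP hP' hg hσ
  obtain ⟨w, hw⟩ := hram.smul σ
  have hφ : ∀ u : (Carlitz.integers F P)ˣ,
      (Carlitz.unitsAut F P σ u : Carlitz.integers F P) = σ • (u : Carlitz.integers F P) :=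
    fun u => rfl
  -- As `w` is the unit `x / σ(x)`, the identities asserted in `K_P` are identities between units.
  have hconv : ∀ (ℓ : ℕ) (κ : (Carlitz.integers F P)ˣ),
      (((ε : Carlitz.integers F P) : Carlitz.cyclotomicField F P) =
        (x / Carlitz.carlitz F (Carlitz.cyclotomicField F P) g x) ^ ℓ *
          ((κ : Carlitz.integers F P) : Carlitz.cyclotomicField F P)) ↔ ε = w ^ ℓ * κ := by
    intro ℓ κ
    have hwx : ((x : Carlitz.integers F P) : Carlitz.cyclotomicField F P) /
        Carlitz.carlitz F (Carlitz.cyclotomicField F P) g x = (w : Carlitz.integers F P) := by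
      rw [← Carlitz.coe_carlitz, ← hσ, div_eq_iff, mul_comm]
      · exact (congrArg Subtype.val hw).symm
      · exact fun h0 => (smul_ne_zero_iff_ne σ).2 (h.ne_zero hP hP') (Subtype.ext h0)
    rw [hwx, Units.ext_iff, Units.val_mul, Units.val_pow_eq_pow_val]
    exact ⟨fun h => Subtype.ext h, fun h => congrArg Subtype.val h⟩
  have hnorm : ∏ τ : Gal(Carlitz.cyclotomicField F P / RatFunc F),
      τ • (ε : Carlitz.integers F P) = 1 := by
    apply Subtype.ext
    have := Algebra.norm_eq_prod_automorphisms (RatFunc F)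
      ((ε : Carlitz.integers F P) : Carlitz.cyclotomicField F P)
    rw [hε, map_one] at this
    push_cast
    exact this.symm
  have hfaith : FaithfulSMul Gal(Carlitz.cyclotomicField F P / RatFunc F)
      (Carlitz.integers F P) := ⟨fun hτ => h.smul_injective (hτ x)⟩
  obtain ⟨y, hy, hεy⟩ := InvariantIdeal.exists_mul_smul_eq hgen hnorm
  obtain ⟨ℓ, hℓ, κ, hκ, heq⟩ := hram.exists_eq_pow_mul hgen hφ hw ε hy hεy
  refine ⟨ℓ, κ, by omega, hκ, (hconv ℓ κ).2 heq, fun ℓ' κ' hℓ' hκ' heq' => ?_⟩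
  rw [hconv, heq] at heq'
  obtain rfl := hram.eq_of_pow_mul_eq hgen hφ hw hℓ (by omega) hκ hκ' heq'
  exact ⟨rfl, (mul_left_cancel heq').symm⟩
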